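/- Let $f(x,y)$ be a symmetric real function of two positive real variables. It is called escalating if $$f(x_1,x_2)+f(y_1,y_2)\ \ge\ f(x_2,y_1)+f(x_1,y_2)\qquad\text{for all } x_1\ge y_1>0,\ x_2\ge y_2>0,$$ with strict inequality whenever $x_1>y_1$ and $x_2>y_2$. It is called good escalating if moreover $\frac{\partial f}{\partial x}$ and $\frac{\partial^2 f}{\partial x^2}$ exist on the positive quadrant with $\frac{\partial f}{\partial x}>0$ and $\frac{\partial^2 f}{\partial x^2}\ge 0$, and $$f(x_1+1,x_2)+f(x_1+1,y_1-1)\ \ge\ f(x_2,y_1)+f(x_1,y_1)\qquad\text{for all } x_1\ge y_1>1,\ x_2\ge 1.$$ For a finite simple graph $G$ with vertex degrees $d(\cdot)$ put $M_f(G)=\sum_{uv\in E(G)}f(d(u),d(v))$. A connected simple graph with $n$ vertices and $n+c-1$ edges is called $c$-cyclic. For an escalating $f$, an extremal graph of a class of graphs is a member of the class that maximizes $M_f$ over the class. For $n\ge 4$ let $S_n^{(0)}$ be the star on $n$ vertices; let $S_n^{(1)}$ be obtained from $S_n^{(0)}$ by adding one edge between two pendant vertices; and let $S_n^{(2)}$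 be obtained by attaching $n-4$ pendant vertices to one vertex of degree three of $B_1$, where $B_1$ is the graph on four vertices formed by two triangles sharing an edge (that is, $K_4$ minus an edge). Theorem. Let $n\ge 4$, let $f$ be good escalating and let $c\in\{0,1,2\}$. Then $S_n^{(c)}$ is, up to isomorphism, the unique extremal graph among all $c$-cyclic graphs with $n$ vertices: a $c$-cyclic graph on $n$ vertices maximizes $M_f$ among all of them if and only if it is isomorphic to $S_n^{(c)}$. -/

import Mathlib

/-- A bivariate function on the positive reals, symmetric there.  (Values of `f` at non-positive
arguments are irrelevant.) -/
def SymmetricOnPos (f : ℝ → ℝ → ℝ) : Prop :=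
  ∀ x y : ℝ, 0 < x → 0 < y → f x y = f y x

/-- Escalating functions. -/
structure Escalating (f : ℝ → ℝ → ℝ) : Prop where
  symm : SymmetricOnPos f
  le : ∀ x₁ y₁ x₂ y₂ : ℝ, 0 < y₁ → y₁ ≤ x₁ → 0 < y₂ → y₂ ≤ x₂ →
    f x₂ y₁ + f x₁ y₂ ≤ f x₁ x₂ + f y₁ y₂
  lt : ∀ x₁ y₁ x₂ y₂ : ℝ, 0 < y₁ → y₁ < x₁ → 0 < y₂ → y₂ < x₂ →
    f x₂ y₁ + f x₁ y₂ < f x₁ x₂ + f y₁ y₂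

/-- Good escalating functions: the first two partial derivatives in the first variable exist on the
positive quadrant, the first one is positive and the second one is nonnegative, and a further
inequality holds wherever all its terms are defined (that is, for `y₁ - 1 > 0`). -/
structure GoodEscalating (f : ℝ → ℝ → ℝ) : Prop extends Escalating f where
  diff : ∀ x y : ℝ, 0 < x → 0 < y → DifferentiableAt ℝ (fun t => f t y) x
  deriv_pos : ∀ x y : ℝ, 0 < x → 0 < y → 0 < deriv (fun t => f t y) x
  diff_deriv : ∀ x y : ℝ, 0 < x → 0 < y → DifferentiableAt ℝ (deriv (fun t => f t y)) x
  deriv_deriv_nonneg : ∀ x y : ℝ, 0 < x → 0 < y → 0 ≤ deriv (deriv (fun t => f t y)) x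
  shift : ∀ x₁ y₁ x₂ : ℝ, 1 < y₁ → y₁ ≤ x₁ → 1 ≤ x₂ →
    f x₂ y₁ + f x₁ y₁ ≤ f (x₁ + 1) x₂ + f (x₁ + 1) (y₁ - 1)

open Classical in
/-- The connectivity function `M_f(G) = ∑_{uv ∈ E(G)} f(d(u), d(v))`.  The endpoints of an edge are
read off in an arbitrary order; by symmetry of `f` the order does not matter. -/
noncomputable def connectivityFunction {V : Type*} [Fintype V] (f : ℝ → ℝ → ℝ)
    (G : SimpleGraph V) : ℝ :=
  ∑ e ∈ G.edgeFinset, f (G.degree e.out.1) (G.degree e.out.2)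

/-- A `c`-cyclic graph: a connected graph with `n` vertices and `m = n + c - 1` edges. -/
def IsCCyclic {V : Type*} [Fintype V] (c : ℕ) (G : SimpleGraph V) : Prop :=
  G.Connected ∧ G.edgeSet.ncard + 1 = Fintype.card V + c

/-- `G` is an extremal graph of the class `𝒢` with respect to an escalating function `f`: it
belongs to `𝒢` and maximizes the connectivity function in `𝒢`. -/
def IsExtremal {V : Type*} [Fintype V] (f : ℝ → ℝ → ℝ) (𝒢 : Set (SimpleGraph V))
    (G : SimpleGraph V) : Prop :=
  G ∈ 𝒢 ∧ ∀ H ∈ 𝒢, connectivityFunction f H ≤ connectivityFunction f G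

/-- The star with `n` vertices and centre `0`. -/
def star₀ (n : ℕ) : SimpleGraph (Fin n) :=
  SimpleGraph.fromRel fun i _ => i.val = 0

/-- The star with one additional edge, joining the pendant vertices `1` and `2`. -/
def star₁ (n : ℕ) : SimpleGraph (Fin n) :=
  star₀ n ⊔ SimpleGraph.fromRel fun i j => i.val = 1 ∧ j.val = 2

/-- The graph `B₁`: two triangles `0, 1, 2` and `0, 1, 3` sharing the edge `01`, that is, the
complete graph on four vertices without the edge `23`. -/
def graphB₁ : SimpleGraph (Fin 4) :=
  SimpleGraph.fromRel fun i j => ¬ (i = 2 ∧ j = 3) ∧ ¬ (i = 3 ∧ j = 2)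

/-- The graph obtained from `G` by attaching `k` new pendant vertices to the vertex `v`. -/
def attachPendants {V : Type*} (G : SimpleGraph V) (v : V) (k : ℕ) : SimpleGraph (V ⊕ Fin k) where
  Adj
    | .inl a, .inl b => G.Adj a b
    | .inl a, .inr _ => a = v
    | .inr _, .inl b => b = v
    | .inr _, .inr _ => False
  symm := ⟨by
    rintro (a | i) (b | j) h
    · exact G.adj_symm h
    · exact h
    · exact h
    · exact h⟩
  loopless := ⟨by
    rintro (a | i) h
    · exact G.loopless.irrefl a h
    · exact h⟩

/-- The graph obtained from `B₁` by attaching `n - 4` pendant vertices to the vertex `0` of degree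
three; it has `n` vertices when `4 ≤ n`. -/
def star₂ (n : ℕ) : SimpleGraph (Fin 4 ⊕ Fin (n - 4)) :=
  attachPendants graphB₁ 0 (n - 4)

/-!
If `u` and `v` are adjacent or have a common neighbour, moving to `u` all edges from `v` to vertices
that are neither `u` nor neighbours of `u` (a Kelmans transformation) keeps the graph connected with
the same number of edges. When `d(u) ≥ d(v)` and there is an edge to move, it strictly increases
`M_f`: the weights at a common neighbour do not decrease because `f` is convex in each variable, a
possible loss on the edge `uv` is made up for by the moved edges, by repeated use of the shift
inequality, and, by the degree condition, `u` has an edge whose weight strictly increases, to a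
vertex that is neither `v` nor a neighbour of `v`.

So in an extremal graph such a `u` is already adjacent to every neighbour of `v` other than itself.
Propagating this along edges, a vertex of maximum degree is adjacent to all others, that is, the
graph is a star plus `c` further edges. For `c = 2` two disjoint further edges are impossible: an
endpoint of one and an endpoint of the other have the centre as a common neighbour, and one of them
would have to be adjacent to the second endpoint of the other edge.
-/

section KelmansWeight

/-- Symmetric functions that are strictly increasing and convex in the first variable on the
positive reals and satisfy the shift inequality of `GoodEscalating`: the edge weights `f` for which
the Kelmans transformation increases `connectivityFunction f`. -/
structure KelmansWeight (f : ℝ → ℝ → ℝ) : Prop where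
  symm : SymmetricOnPos f
  strictMonoOn : ∀ y : ℝ, 0 < y → StrictMonoOn (fun t => f t y) (Set.Ioi 0)
  convexOn : ∀ y : ℝ, 0 < y → ConvexOn ℝ (Set.Ioi 0) (fun t => f t y)
  shift : ∀ x₁ y₁ x₂ : ℝ, 1 < y₁ → y₁ ≤ x₁ → 1 ≤ x₂ →
    f x₂ y₁ + f x₁ y₁ ≤ f (x₁ + 1) x₂ + f (x₁ + 1) (y₁ - 1)

theorem GoodEscalating.kelmansWeight {f : ℝ → ℝ → ℝ} (hf : GoodEscalating f) :
    KelmansWeight f where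
  symm := hf.symm
  strictMonoOn y hy := strictMonoOn_of_deriv_pos (convex_Ioi 0)
    (fun x hx => (hf.diff x y hx hy).continuousAt.continuousWithinAt)
    (fun x hx => hf.deriv_pos x y (interior_subset hx) hy)
  convexOn y hy := convexOn_of_deriv2_nonneg' (convex_Ioi 0)
    (fun x hx => (hf.diff x y hx hy).differentiableWithinAt)
    (fun x hx => (hf.diff_deriv x y hx hy).differentiableWithinAt)
    (fun x hx => hf.deriv_deriv_nonneg x y hx hy)
  shift := hf.shift

theorem sub_mul_sub_le_of_convexOn {𝕜 : Type*} [Field 𝕜] [LinearOrder 𝕜] [IsStrictOrderedRing 𝕜]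
    {s : Set 𝕜} {g : 𝕜 → 𝕜} (hg : ConvexOn 𝕜 s g) {x y z w : 𝕜} (hx : x ∈ s) (hw : w ∈ s)
    (hxy : x ≤ y) (hyz : y ≤ z) (hzw : z ≤ w) :
    (g y - g x) * (w - z) ≤ (g w - g z) * (y - x) := by
  rcases hxy.eq_or_lt with rfl | hxy
  · simp
  rcases hzw.eq_or_lt with rfl | hzw
  · simp
  rw [← div_le_div_iff₀ (sub_pos.2 hxy) (sub_pos.2 hzw)]
  rcases hyz.eq_or_lt with rfl | hyz
  · exact hg.slope_mono_adjacent hx hw hxy hzw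
  · have hz : z ∈ s := hg.1.ordConnected.out hx hw ⟨(hxy.trans hyz).le, hzw.le⟩
    have hy : y ∈ s := hg.1.ordConnected.out hx hw ⟨hxy.le, (hyz.trans hzw).le⟩
    exact (hg.slope_mono_adjacent hx hz hxy hyz).trans (hg.slope_mono_adjacent hy hw hyz hzw)

namespace KelmansWeight

variable {f : ℝ → ℝ → ℝ} {a b y : ℝ}

theorem apply_le_apply (hf : KelmansWeight f) (ha : 0 < a) (hab : a ≤ b) (hy : 0 < y) :
    f a y ≤ f b y :=
  (hf.strictMonoOn y hy).monotoneOn ha (ha.trans_le hab) hab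

theorem add_le_add_of_shift (hf : KelmansWeight f) {δ : ℝ} (hδ : 0 < δ) (hδb : δ < b)
    (hba : b ≤ a) (hy : 0 < y) : f a y + f b y ≤ f (a + δ) y + f (b - δ) y := by
  have hslope : (f b y - f (b - δ) y) * (a + δ - a) ≤ (f (a + δ) y - f a y) * (b - (b - δ)) :=
    sub_mul_sub_le_of_convexOn (hf.convexOn y hy) (sub_pos.2 hδb)
      (add_pos ((hδ.trans hδb).trans_le hba) hδ) (by linarith) hba (by linarith)
  rw [add_sub_cancel_left, sub_sub_cancel] at hslope
  linarith [le_of_mul_le_mul_right hslope hδ]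

/- One more application of `shift` costs `f (a + k + 1) y - f (b - k) y`. By convexity its
excess over `f (a + k + 1) y - f b y`, the drop from `b` to `b - k`, is at most `k` times the last
unit step. -/
theorem sub_shift_le_mul (hf : KelmansWeight f) (hba : b ≤ a) (hy : 1 ≤ y) (k : ℕ)
    (hk : 1 ≤ b - k) : f a b - f (a + k) (b - k) ≤ k * (f (a + k) y - f b y) := by
  induction k with
  | zero => simp
  | succ k ih =>
    push_cast at hk ⊢
    have : (0 : ℝ) ≤ k := k.cast_nonneg
    have hshift : f y (b - k) + f (a + k) (b - k) ≤
        f (a + k + 1) y + f (a + k + 1) (b - k - 1) :=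
      hf.shift _ _ _ (by linarith) (by linarith) hy
    have hslope : (f b y - f (b - k) y) * (a + k + 1 - (a + k)) ≤
        (f (a + k + 1) y - f (a + k) y) * (b - (b - k)) :=
      sub_mul_sub_le_of_convexOn (hf.convexOn y (by linarith)) (Set.mem_Ioi.2 (by linarith))
        (Set.mem_Ioi.2 (by linarith)) (by linarith) (by linarith) (by linarith)
    rw [hf.symm y (b - k) (by linarith) (by linarith)] at hshift
    rw [← add_assoc, ← sub_sub]
    linear_combination ih (by linarith) + hshift + hslope

end KelmansWeight

end KelmansWeight

section EdgeWeight

variable {V W : Type*} [Fintype V] [Fintype W] {f : ℝ → ℝ → ℝ} {G : SimpleGraph V} {u v x y : V}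

open Classical in
theorem two_nsmul_sum_edgeFinset {M : Type*} [AddCommMonoid M] (G : SimpleGraph V)
    (φ : Sym2 V → M) :
    2 • ∑ e ∈ G.edgeFinset, φ e = ∑ x, ∑ y, if G.Adj x y then φ s(x, y) else 0 := by
  calc 2 • ∑ e ∈ G.edgeFinset, φ e
      = ∑ e ∈ G.edgeFinset, ∑ d : G.Dart with d.edge = e, φ d.edge := by
        rw [← Finset.sum_nsmul]
        refine Finset.sum_congr rfl fun e he => ?_
        rw [← G.dart_edge_fiber_card e (SimpleGraph.mem_edgeFinset.1 he), ← Finset.sum_const]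
        exact Finset.sum_congr rfl fun d hd => by rw [(Finset.mem_filter.1 hd).2]
    _ = ∑ d : G.Dart, φ d.edge :=
        Finset.sum_fiberwise_of_maps_to (fun d _ => SimpleGraph.mem_edgeFinset.2 d.edge_mem) _
    _ = ∑ p : V × V with G.Adj p.1 p.2, φ s(p.1, p.2) :=
        Finset.sum_bij (fun d _ => d.toProd) (fun d _ => by simp)
          (fun _ _ _ _ h => SimpleGraph.Dart.ext _ _ h)
          (fun p hp => ⟨⟨p, (Finset.mem_filter.1 hp).2⟩, Finset.mem_univ _, rfl⟩) (fun _ _ => rfl)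
    _ = ∑ x, ∑ y, if G.Adj x y then φ s(x, y) else 0 := by
        rw [Finset.sum_filter, Fintype.sum_prod_type]

open Classical in
/-- The contribution of the ordered pair `(x, y)` to the connectivity function, zero on non-edges;
summing it over all ordered pairs counts every edge twice. -/
noncomputable def edgeWeight (f : ℝ → ℝ → ℝ) (G : SimpleGraph V) (x y : V) : ℝ :=
  if G.Adj x y then f (G.degree x) (G.degree y) else 0

open Classical in
theorem edgeWeight_of_adj (h : G.Adj x y) :
    edgeWeight f G x y = f (G.degree x) (G.degree y) := if_pos h

theorem edgeWeight_of_not_adj (h : ¬ G.Adj x y) : edgeWeight f G x y = 0 := if_neg h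

open Classical in
theorem one_le_degree_of_adj (h : G.Adj x y) : (1 : ℝ) ≤ G.degree x :=
  Nat.one_le_cast.2 ((G.degree_pos_iff_exists_adj x).2 ⟨y, h⟩)

open Classical in
theorem apply_degree_comm (hf : SymmetricOnPos f) (h : G.Adj x y) :
    f (G.degree x) (G.degree y) = f (G.degree y) (G.degree x) :=
  hf _ _ (zero_lt_one.trans_le (one_le_degree_of_adj h))
    (zero_lt_one.trans_le (one_le_degree_of_adj h.symm))

theorem edgeWeight_comm (hf : SymmetricOnPos f) (G : SimpleGraph V) (x y : V) :
    edgeWeight f G x y = edgeWeight f G y x := by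
  by_cases h : G.Adj x y
  · rw [edgeWeight_of_adj h, edgeWeight_of_adj h.symm, apply_degree_comm hf h]
  · rw [edgeWeight_of_not_adj h, edgeWeight_of_not_adj (fun h' => h h'.symm)]

open Classical in
theorem two_mul_connectivityFunction (hf : SymmetricOnPos f) (G : SimpleGraph V) :
    2 * connectivityFunction f G = ∑ x, ∑ y, edgeWeight f G x y := by
  rw [two_mul, ← two_nsmul, connectivityFunction, two_nsmul_sum_edgeFinset]
  refine Finset.sum_congr rfl fun x _ => Finset.sum_congr rfl fun y _ =>
    if_ctx_congr Iff.rfl (fun h => ?_) fun _ => rfl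
  have hout : s(s(x, y).out.1, s(x, y).out.2) = s(x, y) := Quot.out_eq s(x, y)
  obtain ⟨hx, hy⟩ | ⟨hx, hy⟩ := Sym2.eq_iff.1 hout
  · rw [hx, hy]
  · rw [hx, hy, apply_degree_comm hf h]

open Classical in
theorem connectivityFunction_congr (hf : SymmetricOnPos f) {H : SimpleGraph W} (e : G ≃g H) :
    connectivityFunction f G = connectivityFunction f H := by
  have hweight (x y : V) : edgeWeight f H (e x) (e y) = edgeWeight f G x y := by
    simp only [edgeWeight, e.map_adj_iff, e.degree_eq]
  refine mul_left_cancel₀ two_ne_zero ?_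
  rw [two_mul_connectivityFunction hf, two_mul_connectivityFunction hf,
    ← e.toEquiv.sum_comp]
  refine Finset.sum_congr rfl fun x _ => ?_
  rw [← e.toEquiv.sum_comp]
  exact Finset.sum_congr rfl fun y _ => (hweight x y).symm

open Classical in
theorem sum_eq_add_add_sum_compl_pair {M : Type*} [AddCommMonoid M] (huv : u ≠ v) (h : V → M) :
    ∑ x, h x = h u + h v + ∑ x ∈ {u, v}ᶜ, h x := by
  rw [← Finset.sum_add_sum_compl {u, v}, Finset.sum_pair huv]

open Classical in
theorem connectivityFunction_eq_add (hf : SymmetricOnPos f) (G : SimpleGraph V) (huv : u ≠ v) :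
    connectivityFunction f G = edgeWeight f G u v
      + ∑ x ∈ {u, v}ᶜ, (edgeWeight f G u x + edgeWeight f G v x)
      + (∑ x ∈ {u, v}ᶜ, ∑ y ∈ {u, v}ᶜ, edgeWeight f G x y) / 2 := by
  have hself (x : V) : edgeWeight f G x x = 0 := edgeWeight_of_not_adj (G.irrefl)
  have htwo := two_mul_connectivityFunction hf G
  simp_rw [sum_eq_add_add_sum_compl_pair huv, Finset.sum_add_distrib, hself,
    edgeWeight_comm hf G _ u, edgeWeight_comm hf G _ v, edgeWeight_comm hf G v u] at htwo
  rw [Finset.sum_add_distrib]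
  linear_combination htwo / 2

end EdgeWeight

section Kelmans

variable {V : Type*} {G : SimpleGraph V} {u v x y : V}

/-- The neighbours of `v` which are neither `u` nor neighbours of `u`. -/
def privateNeighbors (G : SimpleGraph V) (v u : V) : Set V :=
  G.neighborSet v \ insert u (G.neighborSet u)

theorem mem_privateNeighbors :
    x ∈ privateNeighbors G v u ↔ G.Adj v x ∧ x ≠ u ∧ ¬ G.Adj u x := by
  simp only [privateNeighbors, Set.mem_sdiff, Set.mem_insert_iff, SimpleGraph.mem_neighborSet,
    not_or]

/-- The Kelmans transformation of `G` from `v` to `u`: every edge from `v` to a private neighbour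
of `v` is replaced by the edge from `u` to the same vertex. -/
def kelmans (G : SimpleGraph V) (u v : V) : SimpleGraph V :=
  (G \ .fromRel fun x y => x = v ∧ y ∈ privateNeighbors G v u) ⊔
    .fromRel fun x y => x = u ∧ y ∈ privateNeighbors G v u

theorem kelmans_adj :
    (kelmans G u v).Adj x y ↔ x ≠ y ∧
      (G.Adj x y ∧ ¬ (x = v ∧ y ∈ privateNeighbors G v u) ∧
          ¬ (y = v ∧ x ∈ privateNeighbors G v u) ∨
        x = u ∧ y ∈ privateNeighbors G v u ∨ y = u ∧ x ∈ privateNeighbors G v u) := by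
  simp only [kelmans, SimpleGraph.sup_adj, SimpleGraph.sdiff_adj, SimpleGraph.fromRel_adj]
  grind [SimpleGraph.Adj.ne]

theorem kelmans_adj_left (huv : u ≠ v) :
    (kelmans G u v).Adj u x ↔ G.Adj u x ∨ x ∈ privateNeighbors G v u := by
  rw [kelmans_adj]
  grind [mem_privateNeighbors, SimpleGraph.Adj.ne]

theorem kelmans_adj_right (huv : u ≠ v) :
    (kelmans G u v).Adj v x ↔ G.Adj v x ∧ x ∉ privateNeighbors G v u := by
  rw [kelmans_adj]
  grind [mem_privateNeighbors, SimpleGraph.Adj.ne]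

theorem kelmans_adj_of_ne (hxu : x ≠ u) (hxv : x ≠ v) (hyu : y ≠ u) (hyv : y ≠ v) :
    (kelmans G u v).Adj x y ↔ G.Adj x y := by
  rw [kelmans_adj]
  grind [SimpleGraph.Adj.ne]

theorem neighborSet_kelmans_left (huv : u ≠ v) :
    (kelmans G u v).neighborSet u = G.neighborSet u ∪ privateNeighbors G v u :=
  Set.ext fun _ => kelmans_adj_left huv

theorem neighborSet_kelmans_right (huv : u ≠ v) :
    (kelmans G u v).neighborSet v = G.neighborSet v \ privateNeighbors G v u :=
  Set.ext fun _ => kelmans_adj_right huv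

theorem neighborSet_kelmans_of_mem (hx : x ∈ privateNeighbors G v u) :
    (kelmans G u v).neighborSet x = insert u (G.neighborSet x \ {v}) := by
  ext y
  simp only [SimpleGraph.mem_neighborSet, kelmans_adj, Set.mem_insert_iff, Set.mem_sdiff,
    Set.mem_singleton_iff]
  grind [mem_privateNeighbors, SimpleGraph.Adj.ne]

theorem neighborSet_kelmans_of_notMem (hxu : x ≠ u) (hxv : x ≠ v)
    (hx : x ∉ privateNeighbors G v u) :
    (kelmans G u v).neighborSet x = G.neighborSet x := by
  ext y
  simp only [SimpleGraph.mem_neighborSet, kelmans_adj]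
  grind [SimpleGraph.Adj.ne]

theorem reachable_kelmans (huv : u ≠ v) (h : G.Adj u v ∨ (G.commonNeighbors u v).Nonempty) :
    (kelmans G u v).Reachable u v := by
  rcases h with h | ⟨w, hu, hv⟩
  · exact ((kelmans_adj_left huv).2 (.inl h)).reachable
  · have hw : w ∉ privateNeighbors G v u := fun hw => (mem_privateNeighbors.1 hw).2.2 hu
    exact ((kelmans_adj_left huv).2 (.inl hu)).reachable.trans
      ((kelmans_adj_right huv).2 ⟨hv, hw⟩).symm.reachable

theorem reachable_kelmans_of_adj (huv : u ≠ v)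
    (h : G.Adj u v ∨ (G.commonNeighbors u v).Nonempty) (hxy : G.Adj x y) :
    (kelmans G u v).Reachable x y := by
  have hu {z : V} (hz : G.Adj u z) : (kelmans G u v).Reachable u z :=
    ((kelmans_adj_left huv).2 (.inl hz)).reachable
  have hv {z : V} (hz : G.Adj v z) : (kelmans G u v).Reachable v z := by
    by_cases hP : z ∈ privateNeighbors G v u
    · exact (reachable_kelmans huv h).symm.trans ((kelmans_adj_left huv).2 (.inr hP)).reachable
    · exact ((kelmans_adj_right huv).2 ⟨hz, hP⟩).reachable
  by_cases hends : x = u ∨ x = v ∨ y = u ∨ y = v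
  · rcases hends with rfl | rfl | rfl | rfl
    exacts [hu hxy, hv hxy, (hu hxy.symm).symm, (hv hxy.symm).symm]
  · push Not at hends
    obtain ⟨hxu, hxv, hyu, hyv⟩ := hends
    exact ((kelmans_adj_of_ne hxu hxv hyu hyv).2 hxy).reachable

theorem connected_kelmans (hG : G.Connected) (huv : u ≠ v)
    (h : G.Adj u v ∨ (G.commonNeighbors u v).Nonempty) : (kelmans G u v).Connected where
  preconnected x y := by
    obtain ⟨p⟩ := hG x y
    induction p with
    | nil => exact .rfl
    | cons hxy _ ih => exact (reachable_kelmans_of_adj huv h hxy).trans ih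
  nonempty := hG.nonempty

open Classical in
theorem degree_eq_ncard_neighborSet [Fintype V] (G : SimpleGraph V) (x : V) :
    G.degree x = (G.neighborSet x).ncard := by
  rw [Set.ncard_eq_toFinset_card']
  rfl

open Classical in
theorem degree_kelmans_left [Fintype V] (huv : u ≠ v) :
    (kelmans G u v).degree u = G.degree u + (privateNeighbors G v u).ncard := by
  have hdisj : Disjoint (G.neighborSet u) (privateNeighbors G v u) :=
    Set.disjoint_right.2 fun _ hx hu => (mem_privateNeighbors.1 hx).2.2 hu
  rw [degree_eq_ncard_neighborSet, degree_eq_ncard_neighborSet, neighborSet_kelmans_left huv,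
    Set.ncard_union_eq hdisj]

open Classical in
theorem degree_kelmans_right_add [Fintype V] (huv : u ≠ v) :
    (kelmans G u v).degree v + (privateNeighbors G v u).ncard = G.degree v := by
  have hsub : privateNeighbors G v u ⊆ G.neighborSet v := Set.sdiff_subset
  rw [degree_eq_ncard_neighborSet, degree_eq_ncard_neighborSet, neighborSet_kelmans_right huv,
    Set.ncard_sdiff_add_ncard_of_subset hsub]

open Classical in
theorem degree_kelmans_of_ne [Fintype V] (hxu : x ≠ u) (hxv : x ≠ v) :
    (kelmans G u v).degree x = G.degree x := by
  rw [degree_eq_ncard_neighborSet, degree_eq_ncard_neighborSet]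
  by_cases hx : x ∈ privateNeighbors G v u
  · obtain ⟨hvx, -, hux⟩ := mem_privateNeighbors.1 hx
    rw [neighborSet_kelmans_of_mem hx]
    exact Set.ncard_exchange (fun h => hux h.symm) hvx.symm
  · rw [neighborSet_kelmans_of_notMem hxu hxv hx]

theorem ncard_edgeSet_kelmans [Finite V] (huv : u ≠ v) :
    (kelmans G u v).edgeSet.ncard = G.edgeSet.ncard := by
  classical
  have := Fintype.ofFinite V
  have hsum : ∑ x, (kelmans G u v).degree x = ∑ x, G.degree x := by
    rw [sum_eq_add_add_sum_compl_pair huv, sum_eq_add_add_sum_compl_pair huv,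
      degree_kelmans_left huv, ← degree_kelmans_right_add (G := G) huv,
      Finset.sum_congr rfl fun x hx => ?_]
    · ring
    · simp only [Finset.mem_compl, Finset.mem_insert, Finset.mem_singleton, not_or] at hx
      exact degree_kelmans_of_ne hx.1 hx.2
  rw [SimpleGraph.sum_degrees_eq_twice_card_edges, SimpleGraph.sum_degrees_eq_twice_card_edges]
    at hsum
  rw [← SimpleGraph.coe_edgeFinset, ← SimpleGraph.coe_edgeFinset, Set.ncard_coe_finset,
    Set.ncard_coe_finset]
  exact Nat.eq_of_mul_eq_mul_left two_pos hsum

theorem IsCCyclic.kelmans [Fintype V] {c : ℕ} (hG : IsCCyclic c G) (huv : u ≠ v)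
    (h : G.Adj u v ∨ (G.commonNeighbors u v).Nonempty) : IsCCyclic c (kelmans G u v) :=
  ⟨connected_kelmans hG.1 huv h, by rw [ncard_edgeSet_kelmans huv, hG.2]⟩

open Classical in
theorem nonempty_privateNeighbors [Fintype V] (hd : G.degree v ≤ G.degree u)
    (hP : (privateNeighbors G v u).Nonempty) : (privateNeighbors G u v).Nonempty := by
  by_contra! hempty
  obtain ⟨w, hw⟩ := hP
  obtain ⟨hvw, hwu, huw⟩ := mem_privateNeighbors.1 hw
  have hsub : G.neighborSet u \ {v} ⊂ G.neighborSet v \ {u} := by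
    refine (Set.ssubset_iff_of_subset fun x hx => ?_).2 ⟨w, ⟨hvw, hwu⟩, fun h => huw h.1⟩
    have hxu : ¬ (G.Adj u x ∧ x ≠ v ∧ ¬ G.Adj v x) := mem_privateNeighbors.not.1 (by simp [hempty])
    exact ⟨by_contra fun hvx => hxu ⟨hx.1, hx.2, hvx⟩, hx.1.ne'⟩
  have hlt := Set.ncard_lt_ncard hsub
  rw [degree_eq_ncard_neighborSet, degree_eq_ncard_neighborSet] at hd
  by_cases huv : v ∈ G.neighborSet u
  · have hvu : u ∈ G.neighborSet v := huv.symm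
    rw [← Set.ncard_sdiff_singleton_add_one huv, ← Set.ncard_sdiff_singleton_add_one hvu] at hd
    lia
  · have hvu : u ∉ G.neighborSet v := fun h => huv h.symm
    rw [Set.sdiff_singleton_eq_self huv, Set.sdiff_singleton_eq_self hvu] at hlt
    lia

end Kelmans

section KelmansGain

variable {V : Type*} [Fintype V] {f : ℝ → ℝ → ℝ} {G : SimpleGraph V} {u v x y : V}

open Classical in
theorem edgeWeight_kelmans_of_ne (hxu : x ≠ u) (hxv : x ≠ v) (hyu : y ≠ u) (hyv : y ≠ v) :
    edgeWeight f (kelmans G u v) x y = edgeWeight f G x y := by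
  simp only [edgeWeight, kelmans_adj_of_ne hxu hxv hyu hyv, degree_kelmans_of_ne hxu hxv,
    degree_kelmans_of_ne hyu hyv]

open Classical in
theorem cast_degree_kelmans_right (huv : u ≠ v) :
    ((kelmans G u v).degree v : ℝ) = G.degree v - (privateNeighbors G v u).ncard :=
  eq_sub_of_add_eq (mod_cast degree_kelmans_right_add huv)

open Classical in
theorem edgeWeight_add_le_kelmans (hf : KelmansWeight f) (huv : u ≠ v)
    (hd : G.degree v ≤ G.degree u) (hxu : x ≠ u) (hxv : x ≠ v)
    (hx : x ∉ privateNeighbors G v u) :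
    edgeWeight f G u x + edgeWeight f G v x ≤
      edgeWeight f (kelmans G u v) u x + edgeWeight f (kelmans G u v) v x := by
  by_cases hux : G.Adj u x
  swap
  · have hvx : ¬ G.Adj v x := fun hvx => hx (mem_privateNeighbors.2 ⟨hvx, hxu, hux⟩)
    simp [edgeWeight, hux, hvx, hx, kelmans_adj_left huv, kelmans_adj_right huv]
  have hy : (0 : ℝ) < G.degree x := zero_lt_one.trans_le (one_le_degree_of_adj hux.symm)
  rw [edgeWeight_of_adj hux, edgeWeight_of_adj ((kelmans_adj_left huv).2 (.inl hux)),
    degree_kelmans_left huv, degree_kelmans_of_ne hxu hxv, Nat.cast_add]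
  by_cases hvx : G.Adj v x
  · have hvx' : (kelmans G u v).Adj v x := (kelmans_adj_right huv).2 ⟨hvx, hx⟩
    have hb := one_le_degree_of_adj hvx'
    rw [edgeWeight_of_adj hvx, edgeWeight_of_adj hvx', degree_kelmans_of_ne hxu hxv,
      cast_degree_kelmans_right huv]
    rw [cast_degree_kelmans_right huv] at hb
    rcases (privateNeighbors G v u).ncard.eq_zero_or_pos with hk | hk
    · simp [hk]
    · exact hf.add_le_add_of_shift (Nat.cast_pos.2 hk) (by linarith) (Nat.cast_le.2 hd) hy
  · rw [edgeWeight_of_not_adj hvx,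
      edgeWeight_of_not_adj fun h => hvx ((kelmans_adj_right huv).1 h).1, add_zero, add_zero]
    exact hf.apply_le_apply (zero_lt_one.trans_le (one_le_degree_of_adj hux))
      (le_add_of_nonneg_right (Nat.cast_nonneg _)) hy

open Classical in
theorem edgeWeight_add_lt_kelmans (hf : KelmansWeight f) (huv : u ≠ v)
    (hP : (privateNeighbors G v u).Nonempty) (hx : x ∈ privateNeighbors G u v) :
    edgeWeight f G u x + edgeWeight f G v x <
      edgeWeight f (kelmans G u v) u x + edgeWeight f (kelmans G u v) v x := by
  obtain ⟨hux, hxv, hvx⟩ := mem_privateNeighbors.1 hx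
  have ha : (0 : ℝ) < G.degree u := zero_lt_one.trans_le (one_le_degree_of_adj hux)
  have hk : (0 : ℝ) < (privateNeighbors G v u).ncard :=
    Nat.cast_pos.2 ((Set.ncard_pos (Set.toFinite _)).2 hP)
  rw [edgeWeight_of_adj hux, edgeWeight_of_adj ((kelmans_adj_left huv).2 (.inl hux)),
    edgeWeight_of_not_adj hvx, edgeWeight_of_not_adj fun h => hvx ((kelmans_adj_right huv).1 h).1,
    degree_kelmans_left huv, degree_kelmans_of_ne hux.ne' hxv, Nat.cast_add, add_zero, add_zero]
  exact hf.strictMonoOn _ (zero_lt_one.trans_le (one_le_degree_of_adj hux.symm)) ha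
    (add_pos ha hk) (lt_add_of_pos_right _ hk)

/- The loss on the edge `uv` is shared out equally among the private neighbours of `v`. -/
open Classical in
theorem edgeWeight_add_div_le_kelmans (hf : KelmansWeight f) (huv : u ≠ v)
    (hd : G.degree v ≤ G.degree u) (hx : x ∈ privateNeighbors G v u) :
    edgeWeight f G u x + edgeWeight f G v x +
        (edgeWeight f G u v - edgeWeight f (kelmans G u v) u v) / (privateNeighbors G v u).ncard ≤
      edgeWeight f (kelmans G u v) u x + edgeWeight f (kelmans G u v) v x := by
  obtain ⟨hvx, hxu, hux⟩ := mem_privateNeighbors.1 hx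
  have hy := one_le_degree_of_adj hvx.symm
  have hb := one_le_degree_of_adj hvx
  have hk : (0 : ℝ) < (privateNeighbors G v u).ncard :=
    Nat.cast_pos.2 ((Set.ncard_pos (Set.toFinite _)).2 ⟨x, hx⟩)
  rw [edgeWeight_of_not_adj hux, edgeWeight_of_adj hvx,
    edgeWeight_of_adj (x := u) ((kelmans_adj_left huv).2 (.inr hx)),
    edgeWeight_of_not_adj (x := v) fun h => ((kelmans_adj_right huv).1 h).2 hx,
    degree_kelmans_left huv, degree_kelmans_of_ne hxu hvx.ne', Nat.cast_add, zero_add, add_zero,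
    ← le_sub_iff_add_le', div_le_iff₀' hk]
  by_cases h : G.Adj u v
  · have h' : (kelmans G u v).Adj u v := (kelmans_adj_left huv).2 (.inl h)
    have hb' := one_le_degree_of_adj h'.symm
    rw [edgeWeight_of_adj h, edgeWeight_of_adj h', degree_kelmans_left huv, Nat.cast_add,
      cast_degree_kelmans_right huv]
    rw [cast_degree_kelmans_right huv] at hb'
    exact hf.sub_shift_le_mul (Nat.cast_le.2 hd) hy _ hb'
  · have h' : ¬ (kelmans G u v).Adj u v := fun h' =>
      h ((kelmans_adj_right huv).1 h'.symm).1.symm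
    rw [edgeWeight_of_not_adj h, edgeWeight_of_not_adj h', sub_zero]
    have hda : (G.degree v : ℝ) ≤ G.degree u := Nat.cast_le.2 hd
    exact mul_nonneg hk.le (sub_nonneg.2 (hf.apply_le_apply (by linarith) (by linarith)
      (by linarith)))

open Classical in
theorem sum_ite_mem_div_ncard {ι 𝕜 : Type*} [Field 𝕜] [CharZero 𝕜] {s : Finset ι}
    {t : Set ι} (ht : t.Nonempty) (hts : t ⊆ s) (c : 𝕜) :
    ∑ x ∈ s, (if x ∈ t then c / t.ncard else 0) = c := by
  have hfilter : (({x ∈ s | x ∈ t} : Finset ι) : Set ι) = t := by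
    rw [Finset.coe_filter]
    exact Set.inter_eq_right.2 hts
  have hcard : (t.ncard : 𝕜) ≠ 0 :=
    Nat.cast_ne_zero.2 ((Set.ncard_pos (s.finite_toSet.subset hts)).2 ht).ne'
  rw [← Finset.sum_filter, Finset.sum_const, nsmul_eq_mul, ← Set.ncard_coe_finset, hfilter,
    mul_div_cancel₀ c hcard]

open Classical in
theorem connectivityFunction_lt_kelmans (hf : KelmansWeight f) (huv : u ≠ v)
    (hd : G.degree v ≤ G.degree u) (hP : (privateNeighbors G v u).Nonempty) :
    connectivityFunction f G < connectivityFunction f (kelmans G u v) := by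
  have mem_compl {x : V} : x ∈ ({u, v}ᶜ : Finset V) ↔ x ≠ u ∧ x ≠ v := by
    simp only [Finset.mem_compl, Finset.mem_insert, Finset.mem_singleton, not_or]
  set loss := edgeWeight f G u v - edgeWeight f (kelmans G u v) u v
  have hshare : ∑ x ∈ {u, v}ᶜ, (if x ∈ privateNeighbors G v u
      then loss / (privateNeighbors G v u).ncard else 0) = loss :=
    sum_ite_mem_div_ncard hP (fun x hx => mem_compl.2
      ⟨(mem_privateNeighbors.1 hx).2.1, (mem_privateNeighbors.1 hx).1.ne'⟩) loss
  have hlt : ∑ x ∈ {u, v}ᶜ, (edgeWeight f G u x + edgeWeight f G v x +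
        if x ∈ privateNeighbors G v u then loss / (privateNeighbors G v u).ncard else 0) <
      ∑ x ∈ {u, v}ᶜ,
        (edgeWeight f (kelmans G u v) u x + edgeWeight f (kelmans G u v) v x) := by
    obtain ⟨w, hw⟩ := nonempty_privateNeighbors hd hP
    obtain ⟨huw, hwv, hvw⟩ := mem_privateNeighbors.1 hw
    refine Finset.sum_lt_sum (fun x hx => ?_) ⟨w, mem_compl.2 ⟨huw.ne', hwv⟩, ?_⟩
    · split_ifs with hxP
      · exact edgeWeight_add_div_le_kelmans hf huv hd hxP
      · rw [add_zero]
        exact edgeWeight_add_le_kelmans hf huv hd (mem_compl.1 hx).1 (mem_compl.1 hx).2 hxP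
    · rw [if_neg fun h => hvw (mem_privateNeighbors.1 h).1, add_zero]
      exact edgeWeight_add_lt_kelmans hf huv hP hw
  have hrest : ∑ x ∈ {u, v}ᶜ, ∑ y ∈ {u, v}ᶜ, edgeWeight f (kelmans G u v) x y =
      ∑ x ∈ {u, v}ᶜ, ∑ y ∈ {u, v}ᶜ, edgeWeight f G x y :=
    Finset.sum_congr rfl fun x hx => Finset.sum_congr rfl fun y hy =>
      edgeWeight_kelmans_of_ne (mem_compl.1 hx).1 (mem_compl.1 hx).2 (mem_compl.1 hy).1
        (mem_compl.1 hy).2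
  rw [Finset.sum_add_distrib, hshare] at hlt
  rw [connectivityFunction_eq_add hf.symm G huv, connectivityFunction_eq_add hf.symm _ huv, hrest]
  linarith

end KelmansGain

section Extremal

variable {V W : Type*} [Fintype V] [Fintype W] {f : ℝ → ℝ → ℝ} {c : ℕ}
  {G H : SimpleGraph V} {u v p q r t : V}

theorem IsCCyclic.of_iso {H : SimpleGraph W} (hH : IsCCyclic c H) (e : G ≃g H) : IsCCyclic c G :=
  ⟨e.connected_iff.2 hH.1, by
    rw [Set.ncard_congr' e.mapEdgeSet, Fintype.card_congr e.toEquiv, hH.2]⟩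

theorem isExtremal_iff_nonempty_iso (hf : SymmetricOnPos f) {H : SimpleGraph W}
    (hH : IsCCyclic c H)
    (h : ∀ G : SimpleGraph V, IsExtremal f {H | IsCCyclic c H} G → Nonempty (G ≃g H)) :
    IsExtremal f {H | IsCCyclic c H} G ↔ Nonempty (G ≃g H) := by
  refine ⟨h G, fun ⟨e⟩ => ⟨hH.of_iso e, fun G' hG' => ?_⟩⟩
  obtain ⟨M, hM, hmax⟩ := Set.exists_max_image {H : SimpleGraph V | IsCCyclic c H}
    (connectivityFunction f) (Set.toFinite _) ⟨G, hH.of_iso e⟩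
  obtain ⟨e'⟩ := h M ⟨hM, hmax⟩
  rw [connectivityFunction_congr hf e, ← connectivityFunction_congr hf e']
  exact hmax G' hG'

open Classical in
theorem IsExtremal.adj_of_degree_le (hf : KelmansWeight f)
    (hG : IsExtremal f {H | IsCCyclic c H} G) (huv : u ≠ v)
    (h : G.Adj u v ∨ (G.commonNeighbors u v).Nonempty) (hd : G.degree v ≤ G.degree u)
    (hvx : G.Adj v p) (hpu : p ≠ u) : G.Adj u p := by
  by_contra hup
  exact (hG.2 _ (hG.1.kelmans huv h)).not_gt
    (connectivityFunction_lt_kelmans hf huv hd ⟨p, mem_privateNeighbors.2 ⟨hvx, hpu, hup⟩⟩)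

theorem IsExtremal.exists_isUniversal (hf : KelmansWeight f)
    (hG : IsExtremal f {H | IsCCyclic c H} G) : ∃ u, G.IsUniversal u := by
  classical
  have := hG.1.1.nonempty
  obtain ⟨u, hu⟩ := Finite.exists_max fun x => G.degree x
  refine ⟨u, fun x hux => ?_⟩
  have hreach := (SimpleGraph.reachable_iff_reflTransGen u x).1 (hG.1.1 u x)
  suffices x = u ∨ G.Adj u x from this.resolve_left hux.symm
  clear hux
  induction hreach with
  | refl => exact .inl rfl
  | @tail y z _ hyz ih =>
    rcases ih with rfl | huy
    · exact .inr hyz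
    · exact or_iff_not_imp_left.2 fun hzu =>
        hG.adj_of_degree_le hf huy.ne (.inl huy) (by convert hu y) hyz hzu

theorem IsExtremal.adj_or_adj (hf : KelmansWeight f)
    (hG : IsExtremal f {H | IsCCyclic c H} G) (hpr : p ≠ r)
    (h : (G.commonNeighbors p r).Nonempty) (hpq : G.Adj p q) (hrt : G.Adj r t) (hqr : q ≠ r)
    (htp : t ≠ p) : G.Adj p t ∨ G.Adj r q := by
  classical
  rcases le_total (G.degree r) (G.degree p) with hd | hd
  · exact .inl (hG.adj_of_degree_le hf hpr (.inr h) (by convert hd) hrt htp)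
  · rw [SimpleGraph.commonNeighbors_symm] at h
    exact .inr (hG.adj_of_degree_le hf hpr.symm (.inr h) (by convert hd) hpq hqr)

theorem isCCyclic_starGraph_sup_iff (hH : Disjoint (.starGraph u) H) :
    IsCCyclic c (.starGraph u ⊔ H) ↔ H.edgeSet.ncard = c := by
  have hstar : (SimpleGraph.starGraph u).edgeSet.ncard + 1 = Fintype.card V := by
    classical
    rw [← SimpleGraph.coe_edgeFinset, Set.ncard_coe_finset,
      (SimpleGraph.isTree_starGraph u).card_edgeFinset]
  have hsup : (.starGraph u ⊔ H : SimpleGraph V).edgeSet.ncard =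
      (SimpleGraph.starGraph u).edgeSet.ncard + H.edgeSet.ncard := by
    rw [SimpleGraph.edgeSet_sup, Set.ncard_union_eq (SimpleGraph.disjoint_edgeSet.2 hH)]
  have hconn : (.starGraph u ⊔ H : SimpleGraph V).Connected :=
    (SimpleGraph.connected_starGraph u).mono le_sup_left
  rw [IsCCyclic, and_iff_right hconn]
  lia

theorem IsExtremal.exists_eq_starGraph_sup (hf : KelmansWeight f)
    (hG : IsExtremal f {H | IsCCyclic c H} G) :
    ∃ u H, Disjoint (.starGraph u) H ∧ H.edgeSet.ncard = c ∧ G = .starGraph u ⊔ H := by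
  obtain ⟨u, hu⟩ := hG.exists_isUniversal hf
  have hle : SimpleGraph.starGraph u ≤ G := by
    intro x y hxy
    obtain ⟨hne, rfl | rfl⟩ := SimpleGraph.starGraph_adj.1 hxy
    exacts [hu hne, (hu hne.symm).symm]
  have heq : G = .starGraph u ⊔ G \ .starGraph u := (sup_sdiff_cancel_right hle).symm
  refine ⟨u, G \ .starGraph u, disjoint_sdiff_self_right, ?_, heq⟩
  rw [← isCCyclic_starGraph_sup_iff disjoint_sdiff_self_right, ← heq]
  exact hG.1

end Extremal

section StarWith

variable {ι V W : Type*}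

/-- The star on `V` with centre `a i₀` together with a copy of the pattern graph `T`, placed on the
vertices `a i`. -/
def starWith (T : SimpleGraph ι) (i₀ : ι) (a : ι ↪ V) : SimpleGraph V :=
  .starGraph (a i₀) ⊔ T.map a

variable {T : SimpleGraph ι} {i₀ : ι} {c : ℕ} {f : ℝ → ℝ → ℝ}

theorem starWith_adj {a : ι ↪ V} {x y : V} : (starWith T i₀ a).Adj x y ↔
    x ≠ y ∧ (x = a i₀ ∨ y = a i₀) ∨ ∃ i j, T.Adj i j ∧ a i = x ∧ a j = y := by
  rw [starWith, SimpleGraph.sup_adj, SimpleGraph.starGraph_adj, SimpleGraph.map_adj]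

theorem disjoint_starGraph_iff {H : SimpleGraph V} {u : V} :
    Disjoint (.starGraph u) H ↔ H.IsIsolated u := by
  rw [SimpleGraph.disjoint_left]
  refine ⟨fun h x hx => h u x (SimpleGraph.starGraph_center_adj hx.ne) hx, fun h x y hxy hH => ?_⟩
  obtain ⟨-, rfl | rfl⟩ := SimpleGraph.starGraph_adj.1 hxy
  exacts [h y hH, h x hH.symm]

theorem isCCyclic_starWith_iff [Fintype V] (hT : T.IsIsolated i₀) (a : ι ↪ V) :
    IsCCyclic c (starWith T i₀ a) ↔ T.edgeSet.ncard = c := by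
  have hdisj : Disjoint (.starGraph (a i₀)) (T.map a) := by
    rw [disjoint_starGraph_iff]
    rintro x hx
    obtain ⟨i, j, hij, hi, -⟩ := (SimpleGraph.map_adj _ _ _ _).1 hx
    rw [a.injective hi] at hij
    exact hT j hij
  rw [starWith, isCCyclic_starGraph_sup_iff hdisj, SimpleGraph.edgeSet_map,
    Set.ncard_image_of_injective _ a.sym2Map.injective]

theorem nonempty_iso_starWith [Finite ι] (e : V ≃ W) (a : ι ↪ V) (b : ι ↪ W) :
    Nonempty (starWith T i₀ a ≃g starWith T i₀ b) := by
  obtain ⟨σ, hσ⟩ := Equiv.Perm.exists_extending_pair (e ∘ a) b (e.injective.comp a.injective)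
    b.injective
  refine ⟨⟨e.trans σ, fun {x y} => ?_⟩⟩
  have hb (i : ι) : b i = e.trans σ (a i) := (hσ i).symm
  simp only [starWith_adj, hb, (e.trans σ).apply_eq_iff_eq, ne_eq]

theorem isExtremal_iff_nonempty_iso_starWith [Finite ι] [Fintype V] [Fintype W]
    (hf : SymmetricOnPos f) (hVW : Fintype.card V = Fintype.card W) (hT : T.IsIsolated i₀)
    (hc : T.edgeSet.ncard = c) (b : ι ↪ W)
    (h : ∀ G : SimpleGraph V, IsExtremal f {H | IsCCyclic c H} G → ∃ a, G = starWith T i₀ a)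
    {G : SimpleGraph V} :
    IsExtremal f {H | IsCCyclic c H} G ↔ Nonempty (G ≃g starWith T i₀ b) := by
  refine isExtremal_iff_nonempty_iso hf ((isCCyclic_starWith_iff hT b).2 hc) fun G hG => ?_
  obtain ⟨a, rfl⟩ := h G hG
  exact nonempty_iso_starWith (Fintype.equivOfCardEq hVW) a b

end StarWith

section Classification

open SimpleGraph (edge)

theorem ne_of_isIsolated_of_adj {V : Type*} {H : SimpleGraph V} {u x y : V}
    (hu : H.IsIsolated u) (h : H.Adj x y) : u ≠ x :=
  fun hux => h.not_isIsolated_left (hux ▸ hu)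

variable {V : Type*} [Fintype V] {f : ℝ → ℝ → ℝ} {n : ℕ} {G : SimpleGraph V}

theorem IsExtremal.exists_eq_starWith_bot (hf : KelmansWeight f)
    (hG : IsExtremal f {H | IsCCyclic 0 H} G) :
    ∃ a : Fin 1 ↪ V, G = starWith ⊥ 0 a := by
  obtain ⟨u, H, -, hH, rfl⟩ := hG.exists_eq_starGraph_sup hf
  obtain rfl : H = ⊥ := SimpleGraph.edgeSet_eq_empty.1 ((Set.ncard_eq_zero).1 hH)
  refine ⟨⟨![u], Function.injective_of_subsingleton _⟩, ?_⟩
  ext x y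
  simp [starWith_adj, SimpleGraph.starGraph_adj]

theorem IsExtremal.exists_eq_starWith_edge (hf : KelmansWeight f)
    (hG : IsExtremal f {H | IsCCyclic 1 H} G) :
    ∃ a : Fin 3 ↪ V, G = starWith (edge 1 2) 0 a := by
  obtain ⟨u, H, hu, hH, rfl⟩ := hG.exists_eq_starGraph_sup hf
  rw [disjoint_starGraph_iff] at hu
  obtain ⟨⟨p, q⟩, he⟩ := Set.ncard_eq_one.1 hH
  have hpq : H.Adj p q := by simp [← SimpleGraph.mem_edgeSet, he]
  have hinj : Function.Injective ![u, p, q] := by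
    rw [← List.nodup_ofFn]
    simp [ne_of_isIsolated_of_adj hu hpq, ne_of_isIsolated_of_adj hu hpq.symm, hpq.ne]
  refine ⟨⟨_, hinj⟩, congrArg _ (SimpleGraph.edgeSet_inj.1 ?_)⟩
  rw [SimpleGraph.edgeSet_map, SimpleGraph.edgeSet_edge_of_ne (by decide), Set.image_singleton, he]
  rfl

theorem IsExtremal.exists_common_endpoint (hf : KelmansWeight f) {c : ℕ} {u : V}
    {H : SimpleGraph V} {e e' : Sym2 V} (hG : IsExtremal f {H | IsCCyclic c H} (.starGraph u ⊔ H))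
    (hu : H.IsIsolated u) (he : H.edgeSet = {e, e'}) :
    ∃ p q r, e = s(p, q) ∧ e' = s(p, r) := by
  obtain ⟨p, q⟩ := e
  obtain ⟨r, t⟩ := e'
  have hpq : H.Adj p q := by simp [← SimpleGraph.mem_edgeSet, he]
  have hrt : H.Adj r t := by simp [← SimpleGraph.mem_edgeSet, he]
  have hadj {x y : V} : H.Adj x y ↔ s(x, y) = s(p, q) ∨ s(x, y) = s(r, t) := by
    rw [← SimpleGraph.mem_edgeSet, he]; rfl
  suffices p = r ∨ p = t ∨ q = r ∨ q = t by
    rcases this with rfl | rfl | rfl | rfl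
    · exact ⟨p, q, t, rfl, rfl⟩
    · exact ⟨p, q, r, rfl, Sym2.eq_swap⟩
    · exact ⟨q, p, t, Sym2.eq_swap, rfl⟩
    · exact ⟨q, p, r, Sym2.eq_swap, Sym2.eq_swap⟩
  by_contra! hne
  obtain ⟨hpr, hpt, hqr, hqt⟩ := hne
  have hup : u ≠ p := ne_of_isIsolated_of_adj hu hpq
  have huq : u ≠ q := ne_of_isIsolated_of_adj hu hpq.symm
  have hur : u ≠ r := ne_of_isIsolated_of_adj hu hrt
  have hut : u ≠ t := ne_of_isIsolated_of_adj hu hrt.symm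
  have hcommon : ((.starGraph u ⊔ H : SimpleGraph V).commonNeighbors p r).Nonempty :=
    ⟨u, .inl (SimpleGraph.starGraph_center_adj hup).symm,
      .inl (SimpleGraph.starGraph_center_adj hur).symm⟩
  have hadd := hG.adj_or_adj hf hpr hcommon (.inr hpq) (.inr hrt) hqr hpt.symm
  simp only [SimpleGraph.sup_adj, SimpleGraph.starGraph_adj, hadj, Sym2.eq_iff] at hadd
  grind

theorem IsExtremal.exists_eq_starWith_edge_sup_edge (hf : KelmansWeight f)
    (hG : IsExtremal f {H | IsCCyclic 2 H} G) :
    ∃ a : Fin 4 ↪ V, G = starWith (edge 1 2 ⊔ edge 1 3) 0 a := by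
  obtain ⟨u, H, hu, hH, rfl⟩ := hG.exists_eq_starGraph_sup hf
  obtain ⟨e, e', hne, he⟩ := Set.ncard_eq_two.1 hH
  rw [disjoint_starGraph_iff] at hu
  obtain ⟨p, q, r, rfl, rfl⟩ := hG.exists_common_endpoint hf hu he
  have hpq : H.Adj p q := by simp [← SimpleGraph.mem_edgeSet, he]
  have hpr : H.Adj p r := by simp [← SimpleGraph.mem_edgeSet, he]
  have hinj : Function.Injective ![u, p, q, r] := by
    have hqr : q ≠ r := by rintro rfl; exact hne rfl
    rw [← List.nodup_ofFn]
    simp [ne_of_isIsolated_of_adj hu hpq, ne_of_isIsolated_of_adj hu hpq.symm,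
      ne_of_isIsolated_of_adj hu hpr.symm, hpq.ne, hpr.ne, hqr]
  refine ⟨⟨_, hinj⟩, congrArg _ (SimpleGraph.edgeSet_inj.1 ?_)⟩
  rw [SimpleGraph.edgeSet_map, SimpleGraph.edgeSet_sup, SimpleGraph.edgeSet_edge_of_ne (by decide),
    SimpleGraph.edgeSet_edge_of_ne (by decide), Set.singleton_union, Set.image_pair, he]
  rfl

theorem star₀_eq_starWith (hn : 1 ≤ n) : star₀ n = starWith ⊥ 0 (Fin.castLEEmb hn) := by
  ext x y
  simp [star₀, starWith_adj, Fin.ext_iff]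

theorem star₁_eq_starWith (hn : 3 ≤ n) :
    star₁ n = starWith (edge 1 2) 0 (Fin.castLEEmb hn) := by
  ext x y
  simp only [star₁, star₀, SimpleGraph.sup_adj, SimpleGraph.fromRel_adj, starWith_adj,
    SimpleGraph.edge_adj, Fin.castLEEmb_apply, Fin.ext_iff, Fin.val_castLE]
  constructor
  · rintro (h | ⟨-, ⟨hx, hy⟩ | ⟨hy, hx⟩⟩)
    · exact .inl h
    · exact .inr ⟨1, 2, by simp, hx.symm, hy.symm⟩
    · exact .inr ⟨2, 1, by simp, hx.symm, hy.symm⟩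
  · grind

theorem star₂_eq_starWith :
    star₂ n = starWith (edge 1 2 ⊔ edge 1 3) 0 .inl := by
  ext x y
  rcases x with x | x <;> rcases y with y | y
  · simp only [star₂, attachPendants, graphB₁, SimpleGraph.fromRel_adj, starWith_adj,
      SimpleGraph.sup_adj, SimpleGraph.edge_adj, Function.Embedding.inl_apply, Sum.inl.injEq, ne_eq]
    revert x y
    decide
  all_goals simp [star₂, attachPendants, starWith_adj, eq_comm]

theorem isExtremal_iff_nonempty_iso_star₀ (hf : KelmansWeight f) (hn : 1 ≤ n)
    (hV : Fintype.card V = n) :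
    IsExtremal f {H | IsCCyclic 0 H} G ↔ Nonempty (G ≃g star₀ n) := by
  rw [star₀_eq_starWith hn]
  exact isExtremal_iff_nonempty_iso_starWith hf.symm (by simp [hV]) .bot (by simp) _
    fun G hG => hG.exists_eq_starWith_bot hf

theorem isExtremal_iff_nonempty_iso_star₁ (hf : KelmansWeight f) (hn : 3 ≤ n)
    (hV : Fintype.card V = n) :
    IsExtremal f {H | IsCCyclic 1 H} G ↔ Nonempty (G ≃g star₁ n) := by
  rw [star₁_eq_starWith hn]
  refine isExtremal_iff_nonempty_iso_starWith hf.symm (by simp [hV]) ?_ ?_ _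
    fun G hG => hG.exists_eq_starWith_edge hf
  · simp [SimpleGraph.IsIsolated, SimpleGraph.edge_adj]
  · rw [SimpleGraph.edgeSet_edge_of_ne (by decide), Set.ncard_singleton]

theorem isExtremal_iff_nonempty_iso_star₂ (hf : KelmansWeight f) (hn : 4 ≤ n)
    (hV : Fintype.card V = n) :
    IsExtremal f {H | IsCCyclic 2 H} G ↔ Nonempty (G ≃g star₂ n) := by
  rw [star₂_eq_starWith]
  refine isExtremal_iff_nonempty_iso_starWith hf.symm (by simp [hV, hn]) ?_ ?_ _
    fun G hG => hG.exists_eq_starWith_edge_sup_edge hf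
  · simp [SimpleGraph.IsIsolated, SimpleGraph.edge_adj]
  · rw [SimpleGraph.edgeSet_sup, SimpleGraph.edgeSet_edge_of_ne (by decide),
      SimpleGraph.edgeSet_edge_of_ne (by decide), Set.singleton_union, Set.ncard_pair (by decide)]

end Classification

theorem mainTheorem8_general {V : Type*} [Fintype V] (n : ℕ) (hn : 4 ≤ n)
    (hV : Fintype.card V = n) (f : ℝ → ℝ → ℝ) (hf : KelmansWeight f) :
    (∀ G : SimpleGraph V,
      IsExtremal f {H | IsCCyclic 0 H} G ↔ Nonempty (G ≃g star₀ n)) ∧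
    (∀ G : SimpleGraph V,
      IsExtremal f {H | IsCCyclic 1 H} G ↔ Nonempty (G ≃g star₁ n)) ∧
    (∀ G : SimpleGraph V,
      IsExtremal f {H | IsCCyclic 2 H} G ↔ Nonempty (G ≃g star₂ n)) :=
  ⟨fun _ => isExtremal_iff_nonempty_iso_star₀ hf (by lia) hV,
    fun _ => isExtremal_iff_nonempty_iso_star₁ hf (by lia) hV,
    fun _ => isExtremal_iff_nonempty_iso_star₂ hf hn hV⟩

theorem mainTheorem8 {V : Type*} [Fintype V] (n : ℕ) (hn : 4 ≤ n) (hV : Fintype.card V = n)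
    (f : ℝ → ℝ → ℝ) (hf : GoodEscalating f) :
    (∀ G : SimpleGraph V,
      IsExtremal f {H | IsCCyclic 0 H} G ↔ Nonempty (G ≃g star₀ n)) ∧
    (∀ G : SimpleGraph V,
      IsExtremal f {H | IsCCyclic 1 H} G ↔ Nonempty (G ≃g star₁ n)) ∧
    (∀ G : SimpleGraph V,
      IsExtremal f {H | IsCCyclic 2 H} G ↔ Nonempty (G ≃g star₂ n)) :=
  mainTheorem8_general n hn hV f hf.kelmansWeight
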